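/- Let $G_2(t) = -\tfrac{1}{24} + \sum_{d\ge 1}\sigma(d)\,t^d \in \mathbb{Q}[[t]]$, where $\sigma(d)=\sum_{k\mid d}k$ is the sum of the positive divisors of $d$, and let $G_2'(t)=\sum_{d\ge 1} d\,\sigma(d)\,t^{d-1}$ be its formal derivative. Then the following identity of formal power series in $t$ holds: $$4\,t^2\,G_2'(t^2) = 32\,G_2(t^2)^2 - 40\,G_2(t)\,G_2(t^2) + 8\,G_2(t)^2 - t\,G_2'(t),$$ where $G_2'(t^2)$ denotes the derivative $G_2'$ evaluated at $t^2$. -/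

import Mathlib

open PowerSeries

/-- The weight 2 Eisenstein series `G₂(t) = -1/24 + ∑_{d ≥ 1} σ(d) t ^ d`, as a formal power series
in `t` with rational coefficients; `σ(d)` is the sum of the positive divisors of `d`. -/
noncomputable def G₂ : ℚ⟦X⟧ :=
  PowerSeries.mk fun d => if d = 0 then -(1 / 24 : ℚ) else ((ArithmeticFunction.sigma 1 d : ℕ) : ℚ)

/-- The substitution `F(t) ↦ F(t²)` on formal power series. -/
noncomputable def atSq (F : ℚ⟦X⟧) : ℚ⟦X⟧ :=
  PowerSeries.expand 2 two_ne_zero F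

/-! Write `G₂ = E - 1/24`, where `E` generates `σ`. Coefficients of products of divisor series are
sums over `a x + b y = n`, and Liouville's identity `sum_bilinearReps_liouville` evaluates such sums
of `F (a - b) - F (a + b)`, for even `F`, by divisor sums. The square function gives `E²`; its
restriction to even integers gives a relation between `E²`, `E(t) E(t²)` and `E(t²)²`. Both involve
the series of cubes of divisors, at `t` and `t²`; eliminating it leaves the claim. Liouville's
identity rests on shears preserving `a x + b y`, followed by Euclidean division to compare the
remaining sums. -/

/-! ### Representations `a x + b y = n` and their bijections -/

open Finset in
/-- The quadruples `(a, b, x, y)` of positive integers with `a * x + b * y = n`. -/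
def bilinearReps (n : ℕ) : Finset (ℕ × ℕ × ℕ × ℕ) :=
  {p ∈ Icc 1 n ×ˢ Icc 1 n ×ˢ Icc 1 n ×ˢ Icc 1 n | p.1 * p.2.2.1 + p.2.1 * p.2.2.2 = n}

theorem mem_bilinearReps {n a b x y : ℕ} :
    (a, b, x, y) ∈ bilinearReps n ↔
      0 < a ∧ 0 < b ∧ 0 < x ∧ 0 < y ∧ a * x + b * y = n := by
  simp only [bilinearReps, Finset.mem_filter, Finset.mem_product, Finset.mem_Icc]
  constructor
  · rintro ⟨h, rfl⟩
    refine ⟨?_, ?_, ?_, ?_, rfl⟩ <;> omega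
  · rintro ⟨ha, hb, hx, hy, rfl⟩
    refine ⟨⟨⟨ha, ?_⟩, ⟨hb, ?_⟩, ⟨hx, ?_⟩, hy, ?_⟩, rfl⟩ <;> nlinarith

theorem sum_bilinearReps_swap (n : ℕ) (f : ℕ × ℕ × ℕ × ℕ → ℚ) :
    ∑ p ∈ bilinearReps n, f p = ∑ p ∈ bilinearReps n, f (p.2.1, p.1, p.2.2.2, p.2.2.1) := by
  refine Finset.sum_nbij' (fun p => (p.2.1, p.1, p.2.2.2, p.2.2.1))
    (fun p => (p.2.1, p.1, p.2.2.2, p.2.2.1)) ?_ ?_ ?_ ?_ ?_ <;>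
  rintro ⟨a, b, x, y⟩ h <;> simp only [mem_bilinearReps] at * <;> grind

theorem sum_bilinearReps_transpose (n : ℕ) (f : ℕ × ℕ × ℕ × ℕ → ℚ) :
    ∑ p ∈ bilinearReps n, f p = ∑ p ∈ bilinearReps n, f (p.2.2.1, p.2.2.2, p.1, p.2.1) := by
  refine Finset.sum_nbij' (fun p => (p.2.2.1, p.2.2.2, p.1, p.2.1))
    (fun p => (p.2.2.1, p.2.2.2, p.1, p.2.1)) ?_ ?_ ?_ ?_ ?_ <;>
  rintro ⟨a, b, x, y⟩ h <;> simp only [mem_bilinearReps] at * <;> grind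

/-- The shear rests on `a x + b y = (a - b) x + b (x + y)`. -/
theorem sum_bilinearReps_sub (n : ℕ) (F : ℤ → ℚ) :
    ∑ p ∈ bilinearReps n with p.2.1 < p.1, F (p.1 - p.2.1) =
      ∑ p ∈ bilinearReps n with p.2.2.1 < p.2.2.2, F p.1 := by
  refine Finset.sum_nbij' (fun p => (p.1 - p.2.1, p.2.1, p.2.2.1, p.2.2.1 + p.2.2.2))
    (fun p => (p.1 + p.2.1, p.2.1, p.2.2.1, p.2.2.2 - p.2.2.1)) ?_ ?_ ?_ ?_ ?_ <;>
  rintro ⟨a, b, x, y⟩ h <;> simp only [Finset.mem_filter, mem_bilinearReps] at *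
  · obtain ⟨⟨ha, hb, hx, hy, rfl⟩, h⟩ := h
    obtain ⟨c, rfl⟩ := Nat.exists_eq_add_of_lt h
    refine ⟨⟨by omega, hb, hx, by omega, ?_⟩, by omega⟩
    rw [show b + c + 1 - b = c + 1 by omega]
    ring
  · obtain ⟨⟨ha, hb, hx, hy, rfl⟩, h⟩ := h
    obtain ⟨c, rfl⟩ := Nat.exists_eq_add_of_lt h
    refine ⟨⟨by omega, hb, hx, by omega, ?_⟩, by omega⟩
    rw [show x + c + 1 - x = c + 1 by omega]
    ring
  · simp only [Prod.mk.injEq, true_and]; omega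
  · simp only [Prod.mk.injEq, true_and]; omega
  · rw [Nat.cast_sub h.2.le]

/-- The shear rests on `a x + b y = a (x - y) + (a + b) y`. -/
theorem sum_bilinearReps_add (n : ℕ) (F : ℤ → ℚ) :
    ∑ p ∈ bilinearReps n with p.2.2.2 < p.2.2.1, F (p.1 + p.2.1) =
      ∑ p ∈ bilinearReps n with p.1 < p.2.1, F p.2.1 := by
  refine Finset.sum_nbij' (fun p => (p.1, p.1 + p.2.1, p.2.2.1 - p.2.2.2, p.2.2.2))
    (fun p => (p.1, p.2.1 - p.1, p.2.2.1 + p.2.2.2, p.2.2.2)) ?_ ?_ ?_ ?_ ?_ <;>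
  rintro ⟨a, b, x, y⟩ h <;> simp only [Finset.mem_filter, mem_bilinearReps] at *
  · obtain ⟨⟨ha, hb, hx, hy, rfl⟩, h⟩ := h
    obtain ⟨c, rfl⟩ := Nat.exists_eq_add_of_lt h
    refine ⟨⟨ha, by omega, by omega, hy, ?_⟩, by omega⟩
    rw [show y + c + 1 - y = c + 1 by omega]
    ring
  · obtain ⟨⟨ha, hb, hx, hy, rfl⟩, h⟩ := h
    obtain ⟨c, rfl⟩ := Nat.exists_eq_add_of_lt h
    refine ⟨⟨ha, by omega, by omega, hy, ?_⟩, by omega⟩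
    rw [show a + c + 1 - a = c + 1 by omega]
    ring
  · simp only [Prod.mk.injEq, true_and, and_true]; omega
  · simp only [Prod.mk.injEq, true_and, and_true]; omega
  · rw [Nat.cast_add]

/-- When `x = y`, the equation is `(a + b) x = n`: each divisor `d = a + b` splits in `d - 1` ways.
-/
theorem sum_bilinearReps_add_diag (n : ℕ) (F : ℤ → ℚ) :
    ∑ p ∈ bilinearReps n with p.2.2.1 = p.2.2.2, F (p.1 + p.2.1) =
      ∑ d ∈ n.divisors, ((d : ℚ) - 1) * F d := by
  have key : ∀ d ∈ n.divisors, ((d : ℚ) - 1) * F d = ∑ _a ∈ Finset.Ico 1 d, F d := by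
    intro d hd
    rw [Finset.sum_const, Nat.card_Ico, nsmul_eq_mul, Nat.cast_sub (Nat.pos_of_mem_divisors hd)]
    simp
  rw [Finset.sum_congr rfl key, Finset.sum_sigma']
  refine Finset.sum_nbij' (fun p => ⟨p.1 + p.2.1, p.1⟩)
    (fun q => (q.2, q.1 - q.2, n / q.1, n / q.1)) ?_ ?_ ?_ ?_ ?_
  · rintro ⟨a, b, x, y⟩ h
    simp only [Finset.mem_filter, mem_bilinearReps, Finset.mem_sigma, Nat.mem_divisors,
      Finset.mem_Ico] at *
    obtain ⟨⟨ha, hb, hx, hy, rfl⟩, rfl⟩ := h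
    exact ⟨⟨⟨x, by ring⟩, by positivity⟩, by omega⟩
  · rintro ⟨d, a⟩ h
    simp only [Finset.mem_filter, mem_bilinearReps, Finset.mem_sigma, Nat.mem_divisors,
      Finset.mem_Ico] at *
    obtain ⟨⟨⟨m, rfl⟩, h0⟩, h1, h2⟩ := h
    rw [Nat.mul_div_cancel_left _ (by omega)]
    have hm : 0 < m := Nat.pos_of_ne_zero (right_ne_zero_of_mul h0)
    refine ⟨⟨h1, by omega, hm, hm, ?_⟩, trivial⟩
    rw [← add_mul, Nat.add_sub_cancel' h2.le]
  · rintro ⟨a, b, x, y⟩ h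
    simp only [Finset.mem_filter, mem_bilinearReps] at *
    obtain ⟨⟨ha, hb, hx, hy, rfl⟩, rfl⟩ := h
    rw [← add_mul, Nat.mul_div_cancel_left _ (by omega), Nat.add_sub_cancel_left]
  · rintro ⟨d, a⟩ h
    simp only [Finset.mem_sigma, Finset.mem_Ico] at h
    simp only [Nat.add_sub_cancel' h.2.2.le]
  · rintro ⟨a, b, x, y⟩ h
    simp

theorem sum_bilinearReps_sub_diag (n : ℕ) (F : ℤ → ℚ) :
    ∑ p ∈ bilinearReps n with p.1 = p.2.1, F (p.1 - p.2.1) =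
      ∑ d ∈ n.divisors, ((d : ℚ) - 1) * F 0 := by
  rw [← sum_bilinearReps_add_diag n fun _ => F 0, Finset.sum_filter, Finset.sum_filter,
    sum_bilinearReps_transpose]
  refine Finset.sum_congr rfl fun p _ => ?_
  dsimp only
  split_ifs with h
  · rw [h, sub_self]
  · rfl

/-- If `b = a k`, then `n / a = x + k y` with `0 < x < y`, so `x` and `k` are the remainder and
quotient by `y`; positivity of `x` excludes `y ∣ n / a`. -/
theorem sum_bilinearReps_dvd (n : ℕ) (f : ℕ → ℕ → ℚ) :
    ∑ p ∈ bilinearReps n with p.2.2.1 < p.2.2.2 ∧ p.1 ∣ p.2.1, f p.1 p.2.2.2 =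
      ∑ d ∈ n.divisors, ∑ y ∈ Finset.Icc 1 (n / d) with ¬ y ∣ n / d, f d y := by
  rw [Finset.sum_sigma']
  refine Finset.sum_nbij' (fun p => ⟨p.1, p.2.2.2⟩)
    (fun q => (q.1, q.1 * (n / q.1 / q.2), n / q.1 % q.2, q.2)) ?_ ?_ ?_ ?_ ?_
  · rintro ⟨a, b, x, y⟩ h
    simp only [Finset.mem_filter, mem_bilinearReps, Finset.mem_sigma, Nat.mem_divisors,
      Finset.mem_Icc] at *
    obtain ⟨⟨ha, hb, hx, hy, rfl⟩, hxy, k, rfl⟩ := h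
    have e : a * x + a * k * y = a * (x + k * y) := by ring
    have hk : 0 < k := Nat.pos_of_mul_pos_left hb
    rw [e, Nat.mul_div_cancel_left _ ha]
    refine ⟨⟨⟨_, rfl⟩, by positivity⟩, ⟨hy, by nlinarith⟩, fun hd => ?_⟩
    exact absurd (Nat.le_of_dvd hx ((Nat.dvd_add_left (dvd_mul_left y k)).1 hd)) (by omega)
  · rintro ⟨d, y⟩ h
    simp only [Finset.mem_filter, mem_bilinearReps, Finset.mem_sigma, Nat.mem_divisors,
      Finset.mem_Icc] at *
    obtain ⟨⟨⟨m, rfl⟩, h0⟩, ⟨h1, h2⟩, h3⟩ := h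
    have hd : 0 < d := Nat.pos_of_ne_zero (left_ne_zero_of_mul h0)
    rw [Nat.mul_div_cancel_left _ hd] at *
    refine ⟨⟨hd, Nat.mul_pos hd (Nat.div_pos h2 h1),
      Nat.pos_of_ne_zero fun h => h3 (Nat.dvd_of_mod_eq_zero h), h1, ?_⟩,
      Nat.mod_lt _ h1, dvd_mul_right _ _⟩
    rw [mul_assoc, ← mul_add, mul_comm (m / y), Nat.mod_add_div]
  · rintro ⟨a, b, x, y⟩ h
    simp only [Finset.mem_filter, mem_bilinearReps] at *
    obtain ⟨⟨ha, hb, hx, hy, rfl⟩, hxy, k, rfl⟩ := h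
    have e : a * x + a * k * y = a * (x + k * y) := by ring
    rw [e, Nat.mul_div_cancel_left _ ha, Nat.add_mul_div_right _ _ hy, Nat.div_eq_of_lt hxy,
      Nat.add_mul_mod_self_right, Nat.mod_eq_of_lt hxy, zero_add]
  · rintro ⟨d, y⟩ h
    rfl
  · rintro ⟨a, b, x, y⟩ h
    rfl

/-- Reducing `x` modulo `y` moves the quotient, times `a`, into `b`; reducing `b` modulo `a` undoes
this. Non-divisibility keeps the remainders positive. -/
theorem sum_bilinearReps_mod (n : ℕ) (f : ℕ → ℚ) :
    ∑ p ∈ bilinearReps n with p.2.1 < p.1 ∧ ¬ p.2.2.2 ∣ p.2.2.1, f p.1 =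
      ∑ p ∈ bilinearReps n with p.2.2.1 < p.2.2.2 ∧ ¬ p.1 ∣ p.2.1, f p.1 := by
  refine Finset.sum_nbij'
    (fun p => (p.1, p.2.1 + p.1 * (p.2.2.1 / p.2.2.2), p.2.2.1 % p.2.2.2, p.2.2.2))
    (fun p => (p.1, p.2.1 % p.1, p.2.2.1 + p.2.2.2 * (p.2.1 / p.1), p.2.2.2)) ?_ ?_ ?_ ?_ ?_ <;>
  rintro ⟨a, b, x, y⟩ h <;> simp only [Finset.mem_filter, mem_bilinearReps] at *
  · obtain ⟨⟨ha, hb, hx, hy, rfl⟩, hab, hd⟩ := h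
    refine ⟨⟨ha, by omega, Nat.pos_of_ne_zero fun h => hd (Nat.dvd_of_mod_eq_zero h), hy, ?_⟩,
      Nat.mod_lt _ hy, fun h => ?_⟩
    · conv_rhs => rw [← Nat.mod_add_div x y]
      ring
    · exact absurd (Nat.le_of_dvd hb ((Nat.dvd_add_left (dvd_mul_right _ _)).1 h)) (by omega)
  · obtain ⟨⟨ha, hb, hx, hy, rfl⟩, hxy, hd⟩ := h
    refine ⟨⟨ha, Nat.pos_of_ne_zero fun h => hd (Nat.dvd_of_mod_eq_zero h), by omega, hy, ?_⟩,
      Nat.mod_lt _ ha, fun h => ?_⟩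
    · conv_rhs => rw [← Nat.mod_add_div b a]
      ring
    · exact absurd (Nat.le_of_dvd hx ((Nat.dvd_add_left (dvd_mul_right _ _)).1 h)) (by omega)
  · obtain ⟨⟨ha, hb, hx, hy, rfl⟩, hab, hd⟩ := h
    rw [Nat.add_mul_mod_self_left, Nat.mod_eq_of_lt hab, Nat.add_mul_div_left _ _ ha,
      Nat.div_eq_of_lt hab, zero_add, Nat.mod_add_div]
  · obtain ⟨⟨ha, hb, hx, hy, rfl⟩, hxy, hd⟩ := h
    rw [Nat.add_mul_mod_self_left, Nat.mod_eq_of_lt hxy, Nat.add_mul_div_left _ _ hy,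
      Nat.div_eq_of_lt hxy, zero_add, Nat.mod_add_div]

/-- Both sides run over chains `l ∣ d ∣ n`, grouped by `d` or by `l`. -/
theorem sum_divisors_sum_divisors (n : ℕ) (f : ℕ → ℚ) :
    ∑ d ∈ n.divisors, ∑ l ∈ d.divisors, f l =
      ∑ d ∈ n.divisors, ∑ _l ∈ (n / d).divisors, f d := by
  rw [Finset.sum_sigma', Finset.sum_sigma']
  refine Finset.sum_nbij' (fun q => ⟨q.2, q.1 / q.2⟩) (fun q => ⟨q.1 * q.2, q.1⟩) ?_ ?_ ?_ ?_ ?_ <;>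
  rintro ⟨d, l⟩ h <;> simp only [Finset.mem_sigma, Nat.mem_divisors] at *
  · obtain ⟨⟨⟨m, rfl⟩, h0⟩, ⟨k, rfl⟩, h1⟩ := h
    have hl : 0 < l := Nat.pos_of_ne_zero (left_ne_zero_of_mul h1)
    rw [mul_assoc, Nat.mul_div_cancel_left _ hl, Nat.mul_div_cancel_left _ hl]
    rw [mul_assoc] at h0
    exact ⟨⟨dvd_mul_right _ _, h0⟩, dvd_mul_right _ _, right_ne_zero_of_mul h0⟩
  · obtain ⟨⟨⟨m, rfl⟩, h0⟩, h1, h2⟩ := h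
    have hd : 0 < d := Nat.pos_of_ne_zero (left_ne_zero_of_mul h0)
    rw [Nat.mul_div_cancel_left _ hd] at *
    have hl : l ≠ 0 := by rintro rfl; exact h2 (zero_dvd_iff.1 h1)
    exact ⟨⟨mul_dvd_mul_left _ h1, h0⟩, dvd_mul_right _ _, mul_ne_zero hd.ne' hl⟩
  · rw [Nat.mul_div_cancel' h.2.1]
  · obtain ⟨⟨⟨m, rfl⟩, h0⟩, h1, h2⟩ := h
    rw [Nat.mul_div_cancel_left _ (Nat.pos_of_ne_zero (left_ne_zero_of_mul h0))]

theorem sum_Icc_not_dvd {m : ℕ} (hm : m ≠ 0) (f : ℕ → ℚ) :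
    ∑ y ∈ Finset.Icc 1 m with ¬ y ∣ m, f y =
      ∑ y ∈ Finset.Icc 1 m, f y - ∑ y ∈ m.divisors, f y := by
  have h : m.divisors = {y ∈ Finset.Icc 1 m | y ∣ m} := by
    ext y
    simp only [Nat.mem_divisors, Finset.mem_filter, Finset.mem_Icc]
    exact ⟨fun h => ⟨⟨Nat.pos_of_dvd_of_pos h.1 (by omega), Nat.le_of_dvd (by omega) h.1⟩, h.1⟩,
      fun h => ⟨h.2, hm⟩⟩
  rw [h, ← Finset.sum_filter_add_sum_filter_not (Finset.Icc 1 m) (· ∣ m), add_sub_cancel_left]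

/-! ### Liouville's identity -/

/-- The non-divisible parts cancel by `sum_bilinearReps_mod`; the divisible parts are divisor sums.
-/
theorem sum_bilinearReps_lt_sub_gt (n : ℕ) (f : ℕ → ℚ) :
    ∑ p ∈ bilinearReps n with p.2.2.1 < p.2.2.2, f p.1 -
      ∑ p ∈ bilinearReps n with p.2.1 < p.1, f p.1 =
    ∑ d ∈ n.divisors, ((n / d : ℕ) : ℚ) * f d - ∑ d ∈ n.divisors, ∑ l ∈ Finset.Icc 1 d, f l := by
  have h1 : ∑ p ∈ bilinearReps n with p.2.1 < p.1 ∧ p.2.2.2 ∣ p.2.2.1, f p.1 =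
      ∑ d ∈ n.divisors, ∑ l ∈ Finset.Icc 1 d with ¬ l ∣ d, f l := by
    -- Reversal to `(y, x, b, a)` exchanges the two conditions and moves the weight to the last
    -- entry.
    rw [← Nat.sum_div_divisors, ← sum_bilinearReps_dvd n fun _ y => f y, Finset.sum_filter,
      Finset.sum_filter, sum_bilinearReps_transpose, sum_bilinearReps_swap]
  have h2 := sum_bilinearReps_dvd n fun d _ => f d
  have h3 := sum_bilinearReps_mod n f
  rw [← Finset.sum_filter_add_sum_filter_not ({p ∈ bilinearReps n | p.2.2.1 < p.2.2.2})
      (fun p => p.1 ∣ p.2.1),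
    ← Finset.sum_filter_add_sum_filter_not ({p ∈ bilinearReps n | p.2.1 < p.1})
      (fun p => p.2.2.2 ∣ p.2.2.1)]
  simp only [Finset.filter_filter]
  rw [h1, h2, h3]
  have h4 : ∑ d ∈ n.divisors, ∑ l ∈ Finset.Icc 1 d with ¬ l ∣ d, f l =
      ∑ d ∈ n.divisors, ∑ l ∈ Finset.Icc 1 d, f l - ∑ d ∈ n.divisors, ∑ l ∈ d.divisors, f l := by
    rw [← Finset.sum_sub_distrib]
    exact Finset.sum_congr rfl fun d hd => sum_Icc_not_dvd (Nat.pos_of_mem_divisors hd).ne' f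
  have h5 : ∑ d ∈ n.divisors, ∑ y ∈ Finset.Icc 1 (n / d) with ¬ y ∣ n / d, f d =
      ∑ d ∈ n.divisors, ((n / d : ℕ) : ℚ) * f d -
        ∑ d ∈ n.divisors, ∑ _l ∈ (n / d).divisors, f d := by
    rw [← Finset.sum_sub_distrib]
    refine Finset.sum_congr rfl fun d hd => ?_
    rw [sum_Icc_not_dvd (Nat.div_pos (Nat.divisor_le hd) (Nat.pos_of_mem_divisors hd)).ne'
      fun _ => f d]
    simp
  rw [h4, h5, sum_divisors_sum_divisors]
  ring

/-- Liouville's identity for an even function. -/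
theorem sum_bilinearReps_liouville (n : ℕ) (F : ℤ → ℚ) (hF : ∀ x, F (-x) = F x) :
    ∑ p ∈ bilinearReps n, (F (p.1 - p.2.1) - F (p.1 + p.2.1)) =
      ∑ d ∈ n.divisors, (((d : ℚ) - 1) * F 0 + (2 * ((n / d : ℕ) : ℚ) + 1 - d) * F d -
        2 * ∑ l ∈ Finset.Icc 1 d, F l) := by
  have tri (u v : ℕ × ℕ × ℕ × ℕ → ℕ) (f : ℕ × ℕ × ℕ × ℕ → ℚ) :
      ∑ p ∈ bilinearReps n, f p = ∑ p ∈ bilinearReps n with u p = v p, f p +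
        ∑ p ∈ bilinearReps n with u p < v p, f p + ∑ p ∈ bilinearReps n with v p < u p, f p := by
    simp only [Finset.sum_filter, ← Finset.sum_add_distrib]
    refine Finset.sum_congr rfl fun p _ => ?_
    rcases lt_trichotomy (u p) (v p) with h | h | h
    · simp [h, h.ne, h.not_gt]
    · simp [h]
    · simp [h, h.ne', h.not_gt]
  have s1 : ∑ p ∈ bilinearReps n with p.1 < p.2.1, F (p.1 - p.2.1) =
      ∑ p ∈ bilinearReps n with p.2.1 < p.1, F (p.1 - p.2.1) := by
    rw [Finset.sum_filter, Finset.sum_filter, sum_bilinearReps_swap]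
    refine Finset.sum_congr rfl fun p _ => ?_
    dsimp only
    rw [← hF (p.2.1 - p.1), neg_sub]
  have s2 : ∑ p ∈ bilinearReps n with p.2.2.1 < p.2.2.2, F (p.1 + p.2.1) =
      ∑ p ∈ bilinearReps n with p.2.2.2 < p.2.2.1, F (p.1 + p.2.1) := by
    rw [Finset.sum_filter, Finset.sum_filter, sum_bilinearReps_swap]
    simp only [add_comm]
  have s3 : ∑ p ∈ bilinearReps n with p.1 < p.2.1, F p.2.1 =
      ∑ p ∈ bilinearReps n with p.2.1 < p.1, F p.1 := by
    rw [Finset.sum_filter, Finset.sum_filter, sum_bilinearReps_swap]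
  have h := sum_bilinearReps_lt_sub_gt n fun a => F a
  -- Differences are split by comparing `a` with `b`, sums by comparing `x` with `y`; the two
  -- off-diagonal parts agree, whence the factor 2 on `h`.
  rw [Finset.sum_sub_distrib, tri (fun p => p.1) (fun p => p.2.1), s1, sum_bilinearReps_sub,
    sum_bilinearReps_sub_diag, tri (fun p => p.2.2.1) (fun p => p.2.2.2) fun p => F (p.1 + p.2.1),
    s2, sum_bilinearReps_add, s3, sum_bilinearReps_add_diag]
  simp only [Finset.sum_sub_distrib, Finset.sum_add_distrib, sub_mul, add_mul, ← Finset.mul_sum,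
    mul_assoc] at h ⊢
  linear_combination 2 * h

/-! ### Divisor series, their products and `t ↦ t²` -/

/-- The power series whose `n`-th coefficient is `∑ d ∣ n, u d`, with constant term `0`. -/
noncomputable def divisorSeries (u : ℕ → ℚ) : ℚ⟦X⟧ :=
  PowerSeries.mk fun n => ∑ d ∈ n.divisors, u d

theorem coeff_divisorSeries (u : ℕ → ℚ) (n : ℕ) :
    coeff n (divisorSeries u) = ∑ d ∈ n.divisors, u d :=
  coeff_mk _ _

theorem coeff_divisorSeries_mul (u v : ℕ → ℚ) (n : ℕ) :
    coeff n (divisorSeries u * divisorSeries v) = ∑ p ∈ bilinearReps n, u p.1 * v p.2.1 := by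
  rw [coeff_mul]
  simp only [coeff_divisorSeries, Finset.sum_mul_sum, ← Finset.sum_product']
  rw [Finset.sum_sigma']
  refine Finset.sum_nbij' (fun q => (q.2.1, q.2.2, q.1.1 / q.2.1, q.1.2 / q.2.2))
    (fun p => ⟨(p.1 * p.2.2.1, p.2.1 * p.2.2.2), (p.1, p.2.1)⟩) ?_ ?_ ?_ ?_ ?_
  · rintro ⟨⟨i, j⟩, a, b⟩ h
    simp only [Finset.mem_sigma, Finset.mem_product, Nat.mem_divisors, mem_bilinearReps] at *
    obtain ⟨h, ⟨ha, hi⟩, hb, hj⟩ := h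
    obtain rfl := Finset.HasAntidiagonal.mem_antidiagonal.1 h
    rw [Nat.mul_div_cancel' ha, Nat.mul_div_cancel' hb]
    have ha' := Nat.pos_of_dvd_of_pos ha (Nat.pos_of_ne_zero hi)
    have hb' := Nat.pos_of_dvd_of_pos hb (Nat.pos_of_ne_zero hj)
    exact ⟨ha', hb', Nat.div_pos (Nat.le_of_dvd (Nat.pos_of_ne_zero hi) ha) ha',
      Nat.div_pos (Nat.le_of_dvd (Nat.pos_of_ne_zero hj) hb) hb', rfl⟩
  · rintro ⟨a, b, x, y⟩ h
    simp only [Finset.mem_sigma, Finset.mem_product, Nat.mem_divisors, mem_bilinearReps] at *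
    obtain ⟨ha, hb, hx, hy, rfl⟩ := h
    exact ⟨Finset.HasAntidiagonal.mem_antidiagonal.2 rfl, ⟨dvd_mul_right _ _, by positivity⟩, dvd_mul_right _ _, by positivity⟩
  · rintro ⟨⟨i, j⟩, a, b⟩ h
    simp only [Finset.mem_sigma, Finset.mem_product, Nat.mem_divisors] at h
    simp only [Nat.mul_div_cancel' h.2.1.1, Nat.mul_div_cancel' h.2.2.1]
  · rintro ⟨a, b, x, y⟩ h
    rw [mem_bilinearReps] at h
    simp only [Nat.mul_div_cancel_left _ h.1, Nat.mul_div_cancel_left _ h.2.1]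
  · rintro ⟨⟨i, j⟩, a, b⟩ h
    rfl

theorem coeff_X_mul_derivative (f : ℚ⟦X⟧) (n : ℕ) :
    coeff n (X * derivative ℚ f) = n * coeff n f := by
  cases n with
  | zero => simp
  | succ n => rw [coeff_succ_X_mul, coeff_derivative]; push_cast; ring

theorem X_mul_derivative_atSq (f : ℚ⟦X⟧) :
    X * derivative ℚ (atSq f) = 2 * X ^ 2 * atSq (derivative ℚ f) := by
  have h : X ^ 2 * atSq (derivative ℚ f) = atSq (X * derivative ℚ f) := by simp [atSq]
  rw [mul_assoc, h]
  ext n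
  rw [two_mul, map_add, coeff_X_mul_derivative, atSq, atSq, coeff_expand, coeff_expand,
    coeff_X_mul_derivative]
  split_ifs with h
  · obtain ⟨k, rfl⟩ := h
    simp
    ring
  · simp

/-- Doubling matches the divisors of `n / 2` with the even divisors of an even `n`; an odd `n` has
none. -/
theorem atSq_divisorSeries (u : ℕ → ℚ) :
    atSq (divisorSeries u) = divisorSeries fun d => if Even d then u (d / 2) else 0 := by
  ext n
  rw [atSq, coeff_expand, coeff_divisorSeries, coeff_divisorSeries, ← Finset.sum_filter]
  split_ifs with h
  · refine Finset.sum_nbij' (fun d => 2 * d) (fun d => d / 2) ?_ ?_ ?_ ?_ ?_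
    · intro d hd
      rw [Finset.mem_filter]
      rw [Nat.mem_divisors] at *
      exact ⟨⟨Nat.mul_dvd_of_dvd_div h hd.1, by rintro rfl; simp at hd⟩, even_two_mul d⟩
    · intro d hd
      rw [Finset.mem_filter] at hd
      rw [Nat.mem_divisors] at *
      exact ⟨Nat.div_dvd_div hd.2.two_dvd hd.1.1, by omega⟩
    · intro d _
      simp
    · intro d hd
      rw [Finset.mem_filter] at hd
      exact Nat.mul_div_cancel' hd.2.two_dvd
    · intro d _
      simp
  · refine (Finset.sum_eq_zero fun d hd => ?_).symm
    rw [Finset.mem_filter, Nat.mem_divisors] at hd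
    exact absurd (hd.2.two_dvd.trans hd.1.1) h

theorem atSq_divisorSeries_pow (k : ℕ) :
    atSq (divisorSeries fun d => (d : ℚ) ^ k) =
      divisorSeries fun d => if Even d then ((d : ℚ) / 2) ^ k else 0 := by
  rw [atSq_divisorSeries]
  congr 1
  funext d
  split_ifs with h
  · rw [Nat.cast_div_charZero h.two_dvd, Nat.cast_ofNat]
  · rfl

/-! ### Two instances of Liouville's identity -/

theorem sum_Icc_sq (d : ℕ) :
    ∑ l ∈ Finset.Icc 1 d, (l : ℚ) ^ 2 = d * (d + 1) * (2 * d + 1) / 6 := by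
  induction d with
  | zero => simp
  | succ d ih => rw [Finset.sum_Icc_succ_top (by omega), ih]; push_cast; ring

theorem sum_Icc_even_sq (d : ℕ) :
    ∑ l ∈ Finset.Icc 1 d, (if Even l then (l : ℚ) ^ 2 else 0) =
      if Even d then (d : ℚ) * (d + 1) * (d + 2) / 6 else (d - 1 : ℚ) * d * (d + 1) / 6 := by
  induction d with
  | zero => simp
  | succ d ih =>
    rw [Finset.sum_Icc_succ_top (by omega), ih]
    by_cases h : Even d <;> simp only [h, Nat.even_add_one, not_true_eq_false, not_false_eq_true,
      if_true, if_false] <;> push_cast <;> ring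

theorem cast_div_of_mem_divisors {n d : ℕ} (h : d ∈ n.divisors) :
    ((n / d : ℕ) : ℚ) * d = n := by
  rw [← Nat.cast_mul, Nat.div_mul_cancel (Nat.dvd_of_mem_divisors h)]

/-- The convolution identity `12 σ * σ = 5 σ₃ + (1 - 6 n) σ`. -/
theorem divisorSeries_sq :
    (12 : ℚ) • divisorSeries (fun d => (d : ℚ) ^ 1) ^ 2 =
      (5 : ℚ) • divisorSeries (fun d => (d : ℚ) ^ 3) + divisorSeries (fun d => (d : ℚ) ^ 1) -
        (6 : ℚ) • (X * derivative ℚ (divisorSeries fun d => (d : ℚ) ^ 1)) := by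
  ext n
  have h := sum_bilinearReps_liouville n (fun x => (x : ℚ) ^ 2) fun x => by simp
  simp only [map_add, map_sub, coeff_smul, coeff_X_mul_derivative, sq (divisorSeries _),
    coeff_divisorSeries_mul, coeff_divisorSeries, smul_eq_mul]
  have hl : ∑ p ∈ bilinearReps n, ((((p.1 : ℤ) - p.2.1 : ℤ) : ℚ) ^ 2 -
      (((p.1 : ℤ) + p.2.1 : ℤ) : ℚ) ^ 2) =
      -4 * ∑ p ∈ bilinearReps n, (p.1 : ℚ) ^ 1 * (p.2.1 : ℚ) ^ 1 := by
    rw [Finset.mul_sum]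
    refine Finset.sum_congr rfl fun p _ => ?_
    push_cast
    ring
  have hr : ∀ d ∈ n.divisors, ((d : ℚ) - 1) * ((0 : ℤ) : ℚ) ^ 2 +
      (2 * ((n / d : ℕ) : ℚ) + 1 - d) * ((d : ℤ) : ℚ) ^ 2 -
        2 * ∑ l ∈ Finset.Icc 1 d, ((l : ℤ) : ℚ) ^ 2 =
      2 * n * (d : ℚ) ^ 1 - 5 / 3 * (d : ℚ) ^ 3 - 1 / 3 * (d : ℚ) ^ 1 := by
    intro d hd
    simp only [Int.cast_natCast, Int.cast_zero, sum_Icc_sq]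
    linear_combination 2 * (d : ℚ) * cast_div_of_mem_divisors hd
  rw [hl, Finset.sum_congr rfl hr] at h
  simp only [Finset.sum_sub_distrib, ← Finset.mul_sum] at h
  linear_combination -3 * h

/-- The identity obtained from Liouville's identity for the square function supported on the even
integers. -/
theorem divisorSeries_sq_sub_mul_atSq :
    (12 : ℚ) • divisorSeries (fun d => (d : ℚ) ^ 1) ^ 2 -
      (48 : ℚ) • (divisorSeries (fun d => (d : ℚ) ^ 1) *
        atSq (divisorSeries fun d => (d : ℚ) ^ 1)) +
      (96 : ℚ) • atSq (divisorSeries fun d => (d : ℚ) ^ 1) ^ 2 =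
    divisorSeries (fun d => (d : ℚ) ^ 3) - divisorSeries (fun d => (d : ℚ) ^ 1) +
      (24 : ℚ) • atSq (divisorSeries fun d => (d : ℚ) ^ 3) +
      (6 : ℚ) • atSq (divisorSeries fun d => (d : ℚ) ^ 1) -
      (12 : ℚ) • (X * derivative ℚ (atSq (divisorSeries fun d => (d : ℚ) ^ 1))) := by
  ext n
  have h := sum_bilinearReps_liouville n (fun x => if Even x then (x : ℚ) ^ 2 else 0)
    fun x => by simp
  simp only [atSq_divisorSeries_pow, map_add, map_sub, coeff_smul, coeff_X_mul_derivative,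
    sq (divisorSeries _), coeff_divisorSeries_mul, coeff_divisorSeries, smul_eq_mul]
  have hs := sum_bilinearReps_swap n fun p =>
    (p.1 : ℚ) ^ 1 * if Even p.2.1 then ((p.2.1 : ℚ) / 2) ^ 1 else 0
  -- The left side is `-4ab` when `a` and `b` have equal parity and 0 otherwise; inclusion-exclusion
  -- expresses this by the evenness of `a` and of `b`.
  have hl : ∀ p ∈ bilinearReps n,
      (if Even ((p.1 : ℤ) - p.2.1) then (((p.1 : ℤ) - p.2.1 : ℤ) : ℚ) ^ 2 else 0) -
        (if Even ((p.1 : ℤ) + p.2.1) then (((p.1 : ℤ) + p.2.1 : ℤ) : ℚ) ^ 2 else 0) =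
      -4 * ((p.1 : ℚ) ^ 1 * (p.2.1 : ℚ) ^ 1) +
        8 * ((p.1 : ℚ) ^ 1 * if Even p.2.1 then ((p.2.1 : ℚ) / 2) ^ 1 else 0) +
        8 * ((p.2.1 : ℚ) ^ 1 * if Even p.1 then ((p.1 : ℚ) / 2) ^ 1 else 0) -
        32 * ((if Even p.1 then ((p.1 : ℚ) / 2) ^ 1 else 0) *
          if Even p.2.1 then ((p.2.1 : ℚ) / 2) ^ 1 else 0) := by
    rintro ⟨a, b, x, y⟩ _
    by_cases ha : Even a <;> by_cases hb : Even b <;>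
    simp only [Int.even_sub, Int.even_add, Int.even_coe_nat, ha, hb, iff_true, iff_false,
      not_true_eq_false, if_true, if_false] <;> push_cast <;> ring
  have hr : ∀ d ∈ n.divisors,
      ((d : ℚ) - 1) * (if Even (0 : ℤ) then ((0 : ℤ) : ℚ) ^ 2 else 0) +
      (2 * ((n / d : ℕ) : ℚ) + 1 - d) * (if Even (d : ℤ) then ((d : ℤ) : ℚ) ^ 2 else 0) -
        2 * ∑ l ∈ Finset.Icc 1 d, (if Even (l : ℤ) then ((l : ℤ) : ℚ) ^ 2 else 0) =
      4 * n * (if Even d then ((d : ℚ) / 2) ^ 1 else 0) - 1 / 3 * (d : ℚ) ^ 3 +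
        1 / 3 * (d : ℚ) ^ 1 - 8 * (if Even d then ((d : ℚ) / 2) ^ 3 else 0) -
        2 * (if Even d then ((d : ℚ) / 2) ^ 1 else 0) := by
    intro d hd
    simp only [Int.cast_natCast, Int.cast_zero, Int.even_coe_nat, zero_pow two_ne_zero, ite_self,
      sum_Icc_even_sq]
    split_ifs
    · linear_combination 2 * (d : ℚ) * cast_div_of_mem_divisors hd
    · ring
  rw [Finset.sum_congr rfl hl, Finset.sum_congr rfl hr] at h
  simp only [Finset.sum_sub_distrib, Finset.sum_add_distrib, ← Finset.mul_sum] at h hs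
  linear_combination -3 * h - 24 * hs

/-! ### Elimination of the cubes -/

theorem G₂_eq : G₂ = divisorSeries (fun d => (d : ℚ) ^ 1) - C (1 / 24 : ℚ) := by
  ext n
  rw [G₂, coeff_mk, map_sub, coeff_divisorSeries, coeff_C, ArithmeticFunction.sigma_apply]
  split_ifs with h
  · simp [h]
  · simp

/-- `4 t² G₂′(t²) = 32 G₂(t²)² - 40 G₂(t) G₂(t²) + 8 G₂(t)² - t G₂′(t)` in the ring of formal
power series in `t` (written `X`), where `G₂′` is the formal derivative of `G₂` and `G₂′(t²)` is
that derivative evaluated at `t²`. -/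
theorem lemmaL :
    4 * X ^ 2 * atSq (PowerSeries.derivative ℚ G₂) =
      32 * atSq G₂ ^ 2 - 40 * G₂ * atSq G₂ + 8 * G₂ ^ 2 - X * PowerSeries.derivative ℚ G₂ := by
  have h1 := divisorSeries_sq
  have h2 := congrArg atSq h1
  have h3 := divisorSeries_sq_sub_mul_atSq
  have hd : derivative ℚ G₂ = derivative ℚ (divisorSeries fun d => (d : ℚ) ^ 1) := by
    rw [G₂_eq, map_sub, derivative_C, sub_zero]
  have hs : atSq G₂ = atSq (divisorSeries fun d => (d : ℚ) ^ 1) - C (1 / 24 : ℚ) := by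
    rw [G₂_eq, atSq, map_sub, expand_C, atSq]
  have hc : (24 : ℚ⟦X⟧) * C (1 / 24 : ℚ) = 1 := by
    rw [← map_ofNat (C (R := ℚ)), ← map_mul]
    norm_num
  have h6 : (6 : ℚ⟦X⟧) ≠ 0 := fun h => by
    have h' : constantCoeff (6 : ℚ⟦X⟧) = 6 := map_ofNat _ 6
    rw [h, map_zero] at h'
    norm_num at h'
  rw [X_mul_derivative_atSq] at h3
  rw [hd, hs, G₂_eq]
  simp only [atSq, map_add, map_sub, map_mul, map_pow, map_smul, expand_X] at h2 h3 ⊢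
  simp only [smul_eq_C_mul, map_ofNat] at h1 h2 h3
  refine mul_left_cancel₀ h6 ?_
  set E := divisorSeries fun d => (d : ℚ) ^ 1
  -- The weights 1, 24, -5 cancel the cube series at `t` and `t²`, leaving 6 times the claim; `hc`
  -- handles the constant term of `G₂`.
  linear_combination h1 + 24 * h2 - 5 * h3 + 6 * (expand 2 two_ne_zero E - E) * hc
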